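/- Call a finite lattice $L$ with $n$ elements *dismantlable* if there is a chain $L_1\subset L_2\subset\dots\subset L_n=L$ of sublattices of $L$ with $|L_i|=i$ for all $i=1,\dots,n$. **Theorem 2.3.** Let $G$ be a finite abelian group. Then the subgroup lattice $L(G)$ is dismantlable if and only if one of the following two conditions holds: * $G$ is cyclic and $|G|=p^n$ or $|G|=p^nq^m$ for some primes $p,q$ and integers $n,m\ge 0$; * $G$ is, for some prime $p$, a $p$-group of rank $2$, that is, the minimal number of generators of $G$ is exactly $2$. Moreover, for every prime $p$ such that $G$ is a $p$-group, $G$ has rank at most $2$ if and only if $G$ has no section of type $(p,p,p)$, i.e. there are no subgroups $K\le H\le G$ with $H/K\cong \mathbb{Z}_p\times\mathbb{Z}_p\times\mathbb{Z}_p$. -/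

import Mathlib

/-- A finite lattice `L` with `n` elements is dismantlable if there is a chain
`S 1 ⊂ S 2 ⊂ ⋯ ⊂ S n = L` of sublattices of `L` such that `S i` has exactly `i` elements
for all `i = 1, …, n`. (Values of `S` outside `1, …, n` play no role.) -/
def IsDismantlable (L : Type*) [Lattice L] [Finite L] : Prop :=
  ∃ S : ℕ → Sublattice L,
    (∀ i, 1 ≤ i → i ≤ Nat.card L → (S i : Set L).ncard = i) ∧
    (∀ i, 1 ≤ i → i < Nat.card L → S i < S (i + 1)) ∧
    S (Nat.card L) = ⊤

/-- The group `G` has a section of type `(p, p, p)`: there are subgroups `K ⊴ H ≤ G` such that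
`H / K` is isomorphic to the direct product of three cyclic groups of order `p`. -/
def HasSectionPPP (p : ℕ) (G : Type*) [Group G] : Prop :=
  ∃ (H : Subgroup G) (K : Subgroup H) (_ : K.Normal),
    Nonempty (H ⧸ K ≃* Multiplicative (ZMod p × ZMod p × ZMod p))

/-! The lattice of subgroups of an abelian group is modular. Call the breadth at most two if among
any three elements one lies below the join of the other two. In a finite modular lattice of breadth
at most two, a maximal sup-irreducible element is also meet-irreducible
(`SupIrred.eq_or_eq_of_inf_eq_of_maximal`), so deleting it leaves a sublattice with the same
properties, and deletion can be repeated.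

Breadth above two in `Subgroup G` yields a subgroup mapping onto a product of three groups of prime
order (`Subgroup.exists_surjective_prod_zmod_of_not_le`). With only two primes available, a cyclic
group excludes this; a `p`-group of rank at most two excludes it by counting `p`-torsion
(`HasSectionPPP.three_le_rank`).

Conversely, three nontrivial cyclic factors give three independent subgroups, which obstruct
dismantling (`not_isDismantlable_of_independent`); two factors at most leave only the listed groups.
-/

/-! ### Dismantling modular lattices of breadth at most two -/

/-- In a finite modular lattice of breadth at most two, every maximal sup-irreducible element
is a meet of two elements only trivially. -/
theorem SupIrred.eq_or_eq_of_inf_eq_of_maximal {L : Type*} [Lattice L] [IsModularLattice L]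
    [Finite L] (hb : ∀ x y z : L, x ≤ y ⊔ z ∨ y ≤ x ⊔ z ∨ z ≤ x ⊔ y) {j : L}
    (hj : Maximal SupIrred j) {a b : L} (hab : a ⊓ b = j) : a = j ∨ b = j := by
  by_contra! hne
  have hja : j < a := lt_of_le_of_ne (hab ▸ inf_le_left) hne.1.symm
  have hjb : j < b := lt_of_le_of_ne (hab ▸ inf_le_right) hne.2.symm
  -- a lower cover of `j`, above everything strictly below `j`
  obtain ⟨y, hy⟩ := not_isMin_iff.mp hj.prop.1
  obtain ⟨c, -, hc⟩ := exists_le_covBy_of_lt hy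
  have hcmax : ∀ z, z < j → z ≤ c := fun z hz => by
    rcases hc.eq_or_eq le_sup_right (sup_le hz.le hc.le) with h | h
    · exact h ▸ le_sup_left
    · rcases hj.prop.2 h with h | h
      · exact absurd h hz.ne
      · exact absurd h hc.lt.ne
  -- complements of `j` in its upper covers
  have key : ∀ u, j ⋖ u → ∃ v, v ≤ u ∧ ¬ v ≤ j ∧ j ⊔ v = u ∧ c ⋖ c ⊔ v := by
    intro u hu
    obtain ⟨v, hv⟩ := (Set.toFinite {x | x ≤ u ∧ ¬ x ≤ j}).exists_minimal
      ⟨u, le_rfl, hu.lt.not_ge⟩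
    obtain ⟨⟨hvu, hvj⟩, hmin⟩ := hv
    have hlt : ∀ z, z < v → z ≤ j := fun z hz => by
      by_contra h
      exact hz.not_ge (hmin ⟨hz.le.trans hvu, h⟩ hz.le)
    have hirr : SupIrred v := by
      refine ⟨fun hm => hvj ((hm inf_le_left : v ≤ v ⊓ j).trans inf_le_right), fun s t hst => ?_⟩
      by_contra! h
      refine hvj (hst ▸ sup_le (hlt _ ?_) (hlt _ ?_))
      · exact lt_of_le_of_ne (hst ▸ le_sup_left) h.1
      · exact lt_of_le_of_ne (hst ▸ le_sup_right) h.2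
    -- By maximality of `j`, the sup-irreducible `v` cannot lie above `j` without equalling it.
    have hjv : ¬ j ≤ v := fun h => hvj (hj.2 hirr h)
    have hsup : j ⊔ v = u := by
      rcases hu.eq_or_eq le_sup_left (sup_le hu.le hvu) with h | h
      · exact absurd (h ▸ le_sup_right) hvj
      · exact h
    have hcov : j ⊓ v ⋖ v := inf_covBy_of_covBy_sup_left (hsup.symm ▸ hu)
    have hle : j ⊓ v ≤ c :=
      hcmax _ (lt_of_le_of_ne inf_le_left fun h => hjv (h ▸ inf_le_right))
    have heq : v ⊓ c = j ⊓ v :=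
      le_antisymm (le_inf (inf_le_right.trans hc.le) inf_le_left) (le_inf inf_le_right hle)
    refine ⟨v, hvu, hvj, hsup, ?_⟩
    rw [sup_comm]
    exact covBy_sup_of_inf_covBy_left (heq ▸ hcov)
  obtain ⟨a', ha', ha'a⟩ := exists_covBy_le_of_lt hja
  obtain ⟨b', hb', hb'b⟩ := exists_covBy_le_of_lt hjb
  have hinf : a' ⊓ b' ≤ j := (inf_le_inf ha'a hb'b).trans hab.le
  obtain ⟨v, hva, hvj, hv, hcv⟩ := key a' ha'
  obtain ⟨w, hwb, hwj, hw, hcw⟩ := key b' hb'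
  have hjvw : j ≤ v ⊔ w := by
    rcases hb j v w with h | h | h
    · exact h
    · exact absurd ((le_inf hva (hw ▸ h)).trans hinf) hvj
    · exact absurd ((le_inf (hv ▸ h) hwb).trans hinf) hwj
  have hab' : ¬ b' ≤ a' := fun h => hb'.lt.not_ge ((le_inf h le_rfl).trans hinf)
  have htop : a' ⊔ b' ≤ (c ⊔ v) ⊔ (c ⊔ w) := by
    have hvw : v ⊔ w ≤ (c ⊔ v) ⊔ (c ⊔ w) := sup_le_sup le_sup_right le_sup_right
    rw [← hv, ← hw]
    exact sup_le (sup_le (hjvw.trans hvw) (le_sup_left.trans hvw))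
      (sup_le (hjvw.trans hvw) (le_sup_right.trans hvw))
  -- Lengths now clash: `c < j < a' < a' ⊔ b'` has three steps, but `c ⊔ v` and `c ⊔ w` cover `c`,
  -- so by modularity their join is only two steps above `c`.
  have hlt : c ⊔ v < a' := by
    refine lt_of_le_of_ne (sup_le (hc.le.trans ha'.le) hva) fun h => ?_
    exact hcv.2 hc.lt (h.symm ▸ ha'.lt)
  have hlt' : a' < (c ⊔ v) ⊔ (c ⊔ w) :=
    lt_of_lt_of_le (lt_of_le_of_ne le_sup_left fun h => hab' (h ▸ le_sup_right)) htop
  have hcinf : (c ⊔ w) ⊓ (c ⊔ v) = c := by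
    rcases hcw.eq_or_eq (le_inf le_sup_left le_sup_left) inf_le_left with h | h
    · exact h
    · exact absurd (sup_le hlt.le ((inf_eq_left.mp h).trans hlt.le)) hlt'.not_ge
  have : c ⊔ v ⋖ (c ⊔ v) ⊔ (c ⊔ w) := by
    rw [sup_comm (c ⊔ v)]
    exact covBy_sup_of_inf_covBy_left (hcinf.symm ▸ hcw)
  exact this.2 hlt hlt'

/-- A nontrivial finite modular lattice of breadth at most two has a doubly irreducible element. -/
theorem exists_doubly_irreducible {L : Type*} [Lattice L] [IsModularLattice L]
    [Finite L] [Nontrivial L] (hb : ∀ x y z : L, x ≤ y ⊔ z ∨ y ≤ x ⊔ z ∨ z ≤ x ⊔ y) :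
    ∃ j : L, (∀ a b, a ⊔ b = j → a = j ∨ b = j) ∧ (∀ a b, a ⊓ b = j → a = j ∨ b = j) := by
  have hne : {x : L | SupIrred x}.Nonempty := by
    obtain ⟨x, y, hxy⟩ : ∃ x y : L, ¬ y ≤ x := by
      obtain ⟨x, y, hxy⟩ := exists_pair_ne L
      by_contra! h
      exact hxy (le_antisymm (h y x) (h x y))
    obtain ⟨v, hv⟩ := (Set.toFinite {z : L | ¬ z ≤ x}).exists_minimal ⟨y, hxy⟩
    have hlt : ∀ z, z < v → z ≤ x := fun z hz => by
      by_contra h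
      exact hz.not_ge (hv.2 h hz.le)
    refine ⟨v, fun hm => hv.1 ((hm inf_le_left : v ≤ v ⊓ x).trans inf_le_right),
      fun s t hst => ?_⟩
    by_contra! h
    refine hv.1 (hst ▸ sup_le (hlt _ ?_) (hlt _ ?_))
    · exact lt_of_le_of_ne (hst ▸ le_sup_left) h.1
    · exact lt_of_le_of_ne (hst ▸ le_sup_right) h.2
  obtain ⟨j, hj⟩ := (Set.toFinite {x : L | SupIrred x}).exists_maximal hne
  exact ⟨j, fun a b h => hj.1.2 h, fun a b h =>
    SupIrred.eq_or_eq_of_inf_eq_of_maximal hb hj h⟩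

/-- Lets the search for a doubly irreducible element be repeated inside each sublattice. -/
instance Sublattice.instIsModularLatticeCoe {L : Type*} [Lattice L] [IsModularLattice L]
    (S : Sublattice L) : IsModularLattice S :=
  ⟨fun {x} y {_} h => IsModularLattice.sup_inf_le_assoc_of_le (y : L) (x := (x : L)) h⟩

/-- In a modular lattice of breadth at most two, every finite sublattice with at least two elements
contains a sublattice with exactly one element less. -/
theorem Sublattice.exists_lt_ncard_succ_eq {L : Type*} [Lattice L] [IsModularLattice L] [Finite L]
    (hbr : ∀ x y z : L, x ≤ y ⊔ z ∨ y ≤ x ⊔ z ∨ z ≤ x ⊔ y) (S : Sublattice L)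
    (hS : 2 ≤ (S : Set L).ncard) :
    ∃ T : Sublattice L, T < S ∧ (T : Set L).ncard + 1 = (S : Set L).ncard := by
  have : Nontrivial S := Set.nontrivial_coe_sort.mpr ((Set.one_lt_ncard_iff_nontrivial).mp hS)
  obtain ⟨j, hsup, hinf⟩ := exists_doubly_irreducible (L := S) fun x y z => hbr x y z
  let T : Sublattice L :=
    { carrier := (S : Set L) \ {(j : L)}
      supClosed' := fun a ha b hb => by
        refine ⟨S.supClosed ha.1 hb.1, fun h => ?_⟩
        rcases hsup ⟨a, ha.1⟩ ⟨b, hb.1⟩ (Subtype.ext h) with h | h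
        · exact ha.2 (congrArg Subtype.val h)
        · exact hb.2 (congrArg Subtype.val h)
      infClosed' := fun a ha b hb => by
        refine ⟨S.infClosed ha.1 hb.1, fun h => ?_⟩
        rcases hinf ⟨a, ha.1⟩ ⟨b, hb.1⟩ (Subtype.ext h) with h | h
        · exact ha.2 (congrArg Subtype.val h)
        · exact hb.2 (congrArg Subtype.val h) }
  have hTS : T ≤ S := fun _ hx => hx.1
  have hjT : (j : L) ∉ T := fun h => h.2 rfl
  refine ⟨T, lt_of_le_of_ne hTS fun h => hjT (h.symm ▸ j.2),
    Set.ncard_sdiff_singleton_add_one j.2 (Set.toFinite _)⟩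

/-- A finite modular lattice of breadth at most two is dismantlable. -/
theorem isDismantlable_of_breadth_le_two {L : Type*} [Lattice L] [IsModularLattice L] [Finite L]
    (hb : ∀ x y z : L, x ≤ y ⊔ z ∨ y ≤ x ⊔ z ∨ z ≤ x ⊔ y) : IsDismantlable L := by
  -- The size condition sits inside the existential so that `choose` gives a total function to
  -- iterate.
  have hstep : ∀ S : Sublattice L, ∃ T : Sublattice L, 2 ≤ (S : Set L).ncard →
      T < S ∧ (T : Set L).ncard + 1 = (S : Set L).ncard := fun S => by
    by_cases hS : 2 ≤ (S : Set L).ncard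
    · obtain ⟨T, hT⟩ := S.exists_lt_ncard_succ_eq hb hS
      exact ⟨T, fun _ => hT⟩
    · exact ⟨S, fun h => absurd h hS⟩
  choose f hf using hstep
  have hcard : ∀ k, k < Nat.card L →
      ((f^[k] ⊤ : Sublattice L) : Set L).ncard = Nat.card L - k := fun k => by
    induction k with
    | zero => intro _; simp [Set.ncard_univ]
    | succ k ih =>
      intro hk
      have h1 := ih (by omega)
      rw [Function.iterate_succ_apply']
      have := (hf (f^[k] ⊤) (by omega)).2
      omega
  refine ⟨fun i => f^[Nat.card L - i] ⊤, fun i h1 h2 => ?_, fun i h1 h2 => ?_, by simp⟩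
  · rw [hcard _ (by omega)]; omega
  · have h3 : Nat.card L - i = (Nat.card L - (i + 1)) + 1 := by omega
    simp only [h3, Function.iterate_succ_apply']
    refine (hf _ ?_).1
    rw [hcard _ (by omega)]; omega

/-! ### Obstructions to dismantling -/

/-- Every nonempty subset of a dismantlable lattice contains an element which is neither a join nor
a meet of two other elements of the subset. -/
theorem IsDismantlable.exists_doubly_irreducible {L : Type*} [Lattice L] [Finite L]
    (h : IsDismantlable L) {T : Set L} (hT : T.Nonempty) :
    ∃ x ∈ T, ∀ y ∈ T, ∀ z ∈ T, (y ⊔ z = x ∨ y ⊓ z = x) → y = x ∨ z = x := by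
  classical
  obtain ⟨S, hcard, hlt, htop⟩ := h
  have : Nonempty L := ⟨hT.some⟩
  -- Take the least such `i`. If `i > 1`, the only element of `S i` outside `S (i - 1)` is in `T`,
  -- and the rest of `T` lies in a sublattice avoiding it.
  have hex : ∃ i, 1 ≤ i ∧ i ≤ Nat.card L ∧ T ⊆ S i :=
    ⟨Nat.card L, Nat.card_pos, le_rfl, by simp [htop]⟩
  obtain ⟨h1, h2, h3⟩ := Nat.find_spec hex
  have hmin := fun m => Nat.find_min hex (m := m)
  set i := Nat.find hex
  rcases Nat.eq_or_lt_of_le h1 with hi | hi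
  · obtain ⟨x, hx⟩ := hT
    refine ⟨x, hx, fun y hy z _ _ => Or.inl ?_⟩
    exact (Set.ncard_le_one (Set.toFinite _)).mp ((hcard i h1 h2).trans hi.symm).le y (h3 hy) x (h3 hx)
  · obtain ⟨k, hk⟩ : ∃ k, i = k + 1 := ⟨i - 1, by omega⟩
    have hk1 : 1 ≤ k := by omega
    have hnot : ¬ T ⊆ S k := fun hs => hmin k (by omega) ⟨hk1, by omega, hs⟩
    obtain ⟨x, hx, hxk⟩ := Set.not_subset.mp hnot
    have hsub : ∀ y ∈ T, y ≠ x → y ∈ S k := by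
      intro y hy hyx
      by_contra hyk
      have hle : (S k : Set L) ⊆ S i := hk ▸ (hlt k hk1 (by omega)).le
      have h4 : insert x (insert y (S k : Set L)) ⊆ S i :=
        Set.insert_subset (h3 hx) (Set.insert_subset (h3 hy) hle)
      have h5 := Set.ncard_le_ncard h4 (Set.toFinite _)
      rw [Set.ncard_insert_of_notMem, Set.ncard_insert_of_notMem hyk,
        hcard k hk1 (by omega), hcard i h1 h2] at h5
      · omega
      · rintro (h | h)
        · exact hyx h.symm
        · exact hxk h
    refine ⟨x, hx, fun y hy z hz hyz => ?_⟩
    by_contra! hne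
    have hy' := hsub y hy hne.1
    have hz' := hsub z hz hne.2
    rcases hyz with h | h
    · exact hxk (h ▸ (S k).supClosed hy' hz')
    · exact hxk (h ▸ (S k).infClosed hy' hz')

/-- A modular lattice with three independent nontrivial elements is not dismantlable. -/
theorem not_isDismantlable_of_independent {L : Type*} [Lattice L] [OrderBot L] [IsModularLattice L]
    [Finite L] {a b c : L} (ha : a ≠ ⊥) (hb : b ≠ ⊥) (hc : c ≠ ⊥) (habc : Disjoint a (b ⊔ c))
    (hbac : Disjoint b (a ⊔ c)) (hcab : Disjoint c (a ⊔ b)) : ¬ IsDismantlable L := by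
  intro h
  have hmeet : ∀ {x y z : L}, Disjoint y (x ⊔ z) → (x ⊔ y) ⊓ (x ⊔ z) = x := fun {x y z} hd => by
    rw [sup_inf_assoc_of_le y le_sup_left, hd.eq_bot, sup_bot_eq]
  have hnle : ∀ {x y z : L}, x ≠ ⊥ → Disjoint x (y ⊔ z) → ¬ x ≤ y := fun hx hd hle =>
    hx (hd.eq_bot_of_le (hle.trans le_sup_left))
  have hab := hnle ha habc
  have hac := hnle ha (sup_comm b c ▸ habc)
  have hba := hnle hb hbac
  have hbc := hnle hb (sup_comm a c ▸ hbac)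
  have hca := hnle hc hcab
  have hcb := hnle hc (sup_comm a b ▸ hcab)
  -- These six form a Boolean cube without top and bottom: each single element is a meet of two
  -- pairwise joins, each pairwise join a join of two single elements.
  obtain ⟨x, hx, hirr⟩ := h.exists_doubly_irreducible
    (T := {a, b, c, a ⊔ b, a ⊔ c, b ⊔ c}) ⟨a, by simp⟩
  have e1 : (a ⊔ b) ⊓ (a ⊔ c) = a := hmeet hbac
  have e2 : (a ⊔ b) ⊓ (b ⊔ c) = b := by rw [sup_comm a b]; exact hmeet habc
  have e3 : (a ⊔ c) ⊓ (b ⊔ c) = c := by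
    rw [sup_comm a c, sup_comm b c]; exact hmeet (sup_comm b c ▸ habc)
  simp only [Set.mem_insert_iff, Set.mem_singleton_iff] at hx
  rcases hx with rfl | rfl | rfl | rfl | rfl | rfl
  · rcases hirr (x ⊔ b) (by simp) (x ⊔ c) (by simp) (Or.inr e1) with h | h
    · exact hba (sup_eq_left.mp h)
    · exact hca (sup_eq_left.mp h)
  · rcases hirr (a ⊔ x) (by simp) (x ⊔ c) (by simp) (Or.inr e2) with h | h
    · exact hab (sup_eq_right.mp h)
    · exact hcb (sup_eq_left.mp h)
  · rcases hirr (a ⊔ x) (by simp) (b ⊔ x) (by simp) (Or.inr e3) with h | h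
    · exact hac (sup_eq_right.mp h)
    · exact hbc (sup_eq_right.mp h)
  · rcases hirr a (by simp) b (by simp) (Or.inl rfl) with h | h
    · exact hba (sup_eq_left.mp h.symm)
    · exact hab (sup_eq_right.mp h.symm)
  · rcases hirr a (by simp) c (by simp) (Or.inl rfl) with h | h
    · exact hca (sup_eq_left.mp h.symm)
    · exact hac (sup_eq_right.mp h.symm)
  · rcases hirr b (by simp) c (by simp) (Or.inl rfl) with h | h
    · exact hcb (sup_eq_left.mp h.symm)
    · exact hbc (sup_eq_right.mp h.symm)

/-! ### Quotients of prime order and breadth -/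

/-- A finite abelian group is a product of nontrivial cyclic groups of prime power order. -/
theorem CommGroup.exists_mulEquiv_pi_zmod_prime_pow (G : Type*) [CommGroup G] [Finite G] :
    ∃ (ι : Type) (_ : Fintype ι) (p : ι → ℕ) (e : ι → ℕ), (∀ i, (p i).Prime) ∧ (∀ i, e i ≠ 0) ∧
      Nonempty (G ≃* ((i : ι) → Multiplicative (ZMod (p i ^ e i)))) := by
  classical
  obtain ⟨ι, _, p, hp, e, ⟨f⟩⟩ := AddCommGroup.equiv_directSum_zmod_of_finite (Additive G)
  let g : G ≃* ((i : ι) → Multiplicative (ZMod (p i ^ e i))) := MulEquiv.toAdditive.symm <|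
    f.trans <| (DirectSum.addEquivProd _).trans (MulEquiv.piMultiplicative _).toAdditiveRight
  -- The decomposition may contain trivial factors with `e i = 0`; `r` discards them.
  let r : ((i : ι) → Multiplicative (ZMod (p i ^ e i))) →*
      ((i : {i // e i ≠ 0}) → Multiplicative (ZMod (p i ^ e i))) :=
    { toFun := fun x i => x i
      map_one' := rfl
      map_mul' := fun _ _ => rfl }
  have hr : Function.Bijective r := by
    refine ⟨fun x y hxy => funext fun i => ?_, fun x => ?_⟩
    · by_cases hi : e i = 0
      · have : Subsingleton (ZMod (p i ^ e i)) := by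
          rw [hi, pow_zero]; exact inferInstanceAs (Subsingleton (Fin 1))
        exact Multiplicative.toAdd.injective (Subsingleton.elim _ _)
      · exact congrFun hxy ⟨i, hi⟩
    · refine ⟨fun i => if hi : e i ≠ 0 then x ⟨i, hi⟩ else 1, funext fun i => ?_⟩
      exact dif_pos i.2
  exact ⟨{i // e i ≠ 0}, inferInstance, fun i => p i, fun i => e i, fun i => hp i, fun i => i.2,
    ⟨g.trans (MulEquiv.ofBijective r hr)⟩⟩

/-- The reduction homomorphism `ZMod n → ZMod m` for `m ∣ n`, written multiplicatively. -/
def ZMod.mulCastHom {m n : ℕ} (h : m ∣ n) : Multiplicative (ZMod n) →* Multiplicative (ZMod m) :=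
  (ZMod.castHom h (ZMod m)).toAddMonoidHom.toMultiplicative

theorem ZMod.mulCastHom_surjective {m n : ℕ} (h : m ∣ n) :
    Function.Surjective (ZMod.mulCastHom h) := fun x => by
  obtain ⟨y, hy⟩ := ZMod.castHom_surjective h x.toAdd
  exact ⟨Multiplicative.ofAdd y, congrArg Multiplicative.ofAdd hy⟩

/-- A nontrivial finite abelian group has a quotient of prime order. -/
theorem CommGroup.exists_surjective_zmod_prime (Q : Type*) [CommGroup Q] [Finite Q]
    [Nontrivial Q] : ∃ (p : ℕ) (_ : p.Prime) (f : Q →* Multiplicative (ZMod p)),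
      Function.Surjective f := by
  classical
  obtain ⟨ι, _, p, e, hp, he, ⟨g⟩⟩ := CommGroup.exists_mulEquiv_pi_zmod_prime_pow Q
  obtain ⟨i⟩ : Nonempty ι := by
    by_contra h
    rw [not_nonempty_iff] at h
    exact not_subsingleton Q g.toEquiv.subsingleton
  refine ⟨p i, hp i, (ZMod.mulCastHom (dvd_pow_self (p i) (he i))).comp
    ((Pi.evalMonoidHom _ i).comp g.toMonoidHom), ?_⟩
  exact (ZMod.mulCastHom_surjective _).comp ((Function.surjective_eval i).comp g.surjective)

/-- If `A ⊔ B ⊔ C = ⊤` irredundantly in a finite abelian group, then the group surjects onto a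
product of three groups of prime order. -/
theorem Subgroup.exists_surjective_prod_zmod_of_sup_eq_top {N : Type*} [CommGroup N] [Finite N]
    {A B C : Subgroup N} (h : A ⊔ B ⊔ C = ⊤) (hA : B ⊔ C ≠ ⊤) (hB : A ⊔ C ≠ ⊤)
    (hC : A ⊔ B ≠ ⊤) :
    ∃ p q r : ℕ, p.Prime ∧ q.Prime ∧ r.Prime ∧ ∃ f : N →* Multiplicative (ZMod p) ×
      Multiplicative (ZMod q) × Multiplicative (ZMod r), Function.Surjective f := by
  have key : ∀ M : Subgroup N, M ≠ ⊤ → ∃ (p : ℕ) (_ : p.Prime) (f : N →* Multiplicative (ZMod p)),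
      Function.Surjective f ∧ M ≤ f.ker := fun M hM => by
    have : Nontrivial (N ⧸ M) := QuotientGroup.nontrivial_iff.mpr hM
    obtain ⟨p, hp, f, hf⟩ := CommGroup.exists_surjective_zmod_prime (N ⧸ M)
    refine ⟨p, hp, f.comp (QuotientGroup.mk' M), hf.comp (QuotientGroup.mk'_surjective M),
      fun x hx => ?_⟩
    rw [MonoidHom.mem_ker, MonoidHom.comp_apply, QuotientGroup.mk'_apply, (QuotientGroup.eq_one_iff x).mpr hx, map_one]
  have lift : ∀ {X Y : Subgroup N} {p : ℕ} {f : N →* Multiplicative (ZMod p)},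
      X ⊔ Y = ⊤ → Function.Surjective f → Y ≤ f.ker → ∀ u, ∃ x ∈ X, f x = u := by
    intro X Y p f hXY hf hY u
    obtain ⟨n, rfl⟩ := hf u
    obtain ⟨x, hx, y, hy, rfl⟩ := Subgroup.mem_sup.mp (hXY ▸ Subgroup.mem_top n)
    exact ⟨x, hx, by rw [map_mul, MonoidHom.mem_ker.mp (hY hy), mul_one]⟩
  -- Each map kills two of the three subgroups, hence is onto already on the third; the coordinates
  -- can then be hit independently.
  obtain ⟨p, hp, f, hf, hkf⟩ := key _ hA
  obtain ⟨q, hq, g, hg, hkg⟩ := key _ hB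
  obtain ⟨r, hr, k, hk, hkk⟩ := key _ hC
  refine ⟨p, q, r, hp, hq, hr, f.prod (g.prod k), fun ⟨u, v, w⟩ => ?_⟩
  obtain ⟨a, ha, rfl⟩ := lift (by rw [← sup_assoc, h]) hf hkf u
  obtain ⟨b, hb, rfl⟩ := lift (by rw [← sup_assoc, sup_comm B A, h]) hg hkg v
  obtain ⟨c, hc, rfl⟩ := lift (by rw [sup_comm, h]) hk hkk w
  refine ⟨a * b * c, ?_⟩
  have hz : ∀ {M : Subgroup N} {p : ℕ} {f : N →* Multiplicative (ZMod p)} {x}, M ≤ f.ker →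
      x ∈ M → f x = 1 := fun h hx => MonoidHom.mem_ker.mp (h hx)
  simp [hz hkf (Subgroup.mem_sup_left hb), hz hkf (Subgroup.mem_sup_right hc),
    hz hkg (Subgroup.mem_sup_left ha), hz hkg (Subgroup.mem_sup_right hc),
    hz hkk (Subgroup.mem_sup_left ha), hz hkk (Subgroup.mem_sup_right hb)]

/-- If the subgroup lattice of a finite abelian group has breadth more than two, then some subgroup
surjects onto a product of three groups of prime order. -/
theorem Subgroup.exists_surjective_prod_zmod_of_not_le {G : Type*} [CommGroup G] [Finite G]
    {A B C : Subgroup G} (hA : ¬ A ≤ B ⊔ C) (hB : ¬ B ≤ A ⊔ C) (hC : ¬ C ≤ A ⊔ B) :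
    ∃ (N : Subgroup G) (p q r : ℕ), p.Prime ∧ q.Prime ∧ r.Prime ∧
      ∃ f : N →* Multiplicative (ZMod p) × Multiplicative (ZMod q) × Multiplicative (ZMod r),
        Function.Surjective f := by
  set N := A ⊔ B ⊔ C with hN
  have hAN : A ≤ N := le_sup_left.trans le_sup_left
  have hBN : B ≤ N := le_sup_right.trans le_sup_left
  have hCN : C ≤ N := le_sup_right
  refine ⟨N, Subgroup.exists_surjective_prod_zmod_of_sup_eq_top (A := A.subgroupOf N)
    (B := B.subgroupOf N) (C := C.subgroupOf N) ?_ ?_ ?_ ?_⟩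
  · rw [← Subgroup.subgroupOf_sup hAN hBN, ← Subgroup.subgroupOf_sup (sup_le hAN hBN) hCN,
      Subgroup.subgroupOf_self]
  · rw [← Subgroup.subgroupOf_sup hBN hCN, Ne, Subgroup.subgroupOf_eq_top]
    exact fun h => hA (hAN.trans h)
  · rw [← Subgroup.subgroupOf_sup hAN hCN, Ne, Subgroup.subgroupOf_eq_top]
    exact fun h => hB (hBN.trans h)
  · rw [← Subgroup.subgroupOf_sup hAN hBN, Ne, Subgroup.subgroupOf_eq_top]
    exact fun h => hC (hCN.trans h)

/-- A cyclic group does not surject onto the product of two groups of the same prime order. -/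
theorem IsCyclic.not_surjective_prod_zmod {N : Type*} [Group N] [IsCyclic N] {p : ℕ}
    (hp : p.Prime) (f : N →* Multiplicative (ZMod p) × Multiplicative (ZMod p)) :
    ¬ Function.Surjective f := fun hf => by
  have : NeZero p := ⟨hp.ne_zero⟩
  have := isCyclic_of_surjective f hf
  -- The product has exponent `p` but order `p * p`.
  have h := IsCyclic.exponent_eq_card (α := Multiplicative (ZMod p) × Multiplicative (ZMod p))
  have h1 : Nat.card (Multiplicative (ZMod p)) = p := by
    rw [Nat.card_congr Multiplicative.toAdd, Nat.card_zmod]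
  rw [Monoid.exponent_prod, Monoid.exponent_multiplicative, ZMod.exponent, Nat.card_prod, h1] at h
  simp only [lcm_same, normalize_eq] at h
  have := hp.two_le
  nlinarith

/-- The subgroup lattice of a cyclic group of order `p ^ n * q ^ m` is dismantlable. -/
theorem IsCyclic.isDismantlable_subgroup {G : Type*} [CommGroup G] [Finite G] [IsCyclic G]
    {p q n m : ℕ} (hp : p.Prime) (hq : q.Prime) (hG : Nat.card G = p ^ n * q ^ m) :
    IsDismantlable (Subgroup G) := by
  refine isDismantlable_of_breadth_le_two fun A B C => ?_
  by_contra! h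
  obtain ⟨N, a, b, c, ha, hb, hc, f, hf⟩ :=
    Subgroup.exists_surjective_prod_zmod_of_not_le h.1 h.2.1 h.2.2
  have key : ∀ {t : ℕ}, t.Prime → ∀ g : N →* Multiplicative (ZMod t), Function.Surjective g →
      t = p ∨ t = q := fun {t} ht g hg => by
    have h1 : t ∣ Nat.card G := by
      have := Subgroup.card_dvd_of_surjective g hg
      rw [Nat.card_congr Multiplicative.toAdd, Nat.card_zmod] at this
      exact this.trans N.card_subgroup_dvd_card
    rw [hG] at h1
    rcases ht.dvd_mul.mp h1 with h2 | h2
    · exact Or.inl ((Nat.prime_dvd_prime_iff_eq ht hp).mp (ht.dvd_of_dvd_pow h2))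
    · exact Or.inr ((Nat.prime_dvd_prime_iff_eq ht hq).mp (ht.dvd_of_dvd_pow h2))
  have ka := key ha ((MonoidHom.fst _ _).comp f) (Prod.fst_surjective.comp hf)
  have kb := key hb (((MonoidHom.fst _ _).comp (MonoidHom.snd _ _)).comp f)
    (Prod.fst_surjective.comp (Prod.snd_surjective.comp hf))
  have kc := key hc (((MonoidHom.snd _ _).comp (MonoidHom.snd _ _)).comp f)
    (Prod.snd_surjective.comp (Prod.snd_surjective.comp hf))
  -- Pigeonhole: three primes chosen from `p` and `q`.
  have : a = b ∨ a = c ∨ b = c := by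
    rcases ka with rfl | rfl <;> rcases kb with rfl | rfl <;> rcases kc with rfl | rfl <;> simp
  rcases this with rfl | rfl | rfl
  · refine IsCyclic.not_surjective_prod_zmod ha
      ((((MonoidHom.fst _ _)).prod ((MonoidHom.fst _ _).comp (MonoidHom.snd _ _))).comp f) ?_
    intro ⟨u, v⟩
    obtain ⟨x, hx⟩ := hf (u, v, 1)
    exact ⟨x, by simp [hx]⟩
  · refine IsCyclic.not_surjective_prod_zmod ha
      ((((MonoidHom.fst _ _)).prod ((MonoidHom.snd _ _).comp (MonoidHom.snd _ _))).comp f) ?_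
    intro ⟨u, v⟩
    obtain ⟨x, hx⟩ := hf (u, 1, v)
    exact ⟨x, by simp [hx]⟩
  · exact IsCyclic.not_surjective_prod_zmod hb ((MonoidHom.snd _ _).comp f)
      (Prod.snd_surjective.comp hf)

/-! ### Rank and sections of type `(p, p, p)` -/

theorem HasSectionPPP.of_surjective {p : ℕ} {G : Type*} [Group G] {H : Subgroup G}
    (f : H →* Multiplicative (ZMod p) × Multiplicative (ZMod p) × Multiplicative (ZMod p))
    (hf : Function.Surjective f) : HasSectionPPP p G := by
  let k : Multiplicative (ZMod p) × Multiplicative (ZMod p) × Multiplicative (ZMod p) ≃*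
      Multiplicative (ZMod p × ZMod p × ZMod p) :=
    { toFun := fun x => Multiplicative.ofAdd (x.1.toAdd, x.2.1.toAdd, x.2.2.toAdd)
      invFun := fun y => (Multiplicative.ofAdd y.toAdd.1, Multiplicative.ofAdd y.toAdd.2.1,
        Multiplicative.ofAdd y.toAdd.2.2)
      left_inv := fun _ => rfl
      right_inv := fun _ => rfl
      map_mul' := fun _ _ => rfl }
  exact ⟨H, f.ker, inferInstance, ⟨(QuotientGroup.quotientKerEquivOfSurjective f hf).trans k⟩⟩

/-- An abelian group with a section of type `(p, p, p)` has rank at least three. -/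
theorem HasSectionPPP.three_le_rank {p : ℕ} (hp : p.Prime) {G : Type*} [CommGroup G] [Finite G]
    (h : HasSectionPPP p G) : 3 ≤ Group.rank G := by
  obtain ⟨H, K, _, ⟨f⟩⟩ := h
  have hcard : Nat.card (H ⧸ K) = p ^ 3 := by
    rw [Nat.card_congr f.toEquiv, Nat.card_congr Multiplicative.toAdd, Nat.card_prod,
      Nat.card_prod, Nat.card_zmod]
    ring
  have hexp : (powMonoidHom p : H →* H).range ≤ K := by
    rintro _ ⟨x, rfl⟩
    rw [powMonoidHom_apply, ← QuotientGroup.eq_one_iff, QuotientGroup.mk_pow]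
    apply f.injective
    rw [map_pow, map_one]
    apply Multiplicative.toAdd.injective
    ext <;> simp
  -- For a finite abelian group the `p`-torsion has the order of the quotient by `p`-th powers.
  -- Torsion is monotone in the subgroup, while that quotient of `G` has order at most `p ^
  -- Group.rank G`.
  have h1 : p ^ 3 ≤ Nat.card (powMonoidHom p : H →* H).ker := by
    rw [← hcard, ← Subgroup.index_range]
    exact Subgroup.index_antitone hexp
  have h2 : Nat.card (powMonoidHom p : H →* H).ker ≤ Nat.card (powMonoidHom p : G →* G).ker := by
    refine Nat.card_le_card_of_injective
      (fun x => ⟨(x.1 : G), by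
        have := congrArg (Subtype.val : H → G) (MonoidHom.mem_ker.mp x.2)
        simpa [MonoidHom.mem_ker] using this⟩) fun x y hxy => ?_
    exact Subtype.ext (Subtype.ext (Subtype.mk.inj hxy))
  have h3 : Nat.card (powMonoidHom p : G →* G).ker ≤ p ^ Group.rank G := by
    rw [← Subgroup.index_range]
    have hdvd := card_dvd_exponent_pow_rank' (G := G ⧸ (powMonoidHom p : G →* G).range)
      (n := p) fun g => by
        induction g using QuotientGroup.induction_on with
        | H z =>
          rw [← QuotientGroup.mk_pow, QuotientGroup.eq_one_iff]
          exact ⟨z, rfl⟩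
    refine (Nat.le_of_dvd (pow_pos hp.pos _) hdvd).trans (Nat.pow_le_pow_right hp.pos ?_)
    exact Group.rank_le_of_surjective (QuotientGroup.mk' _) (QuotientGroup.mk'_surjective _)
  exact (Nat.pow_le_pow_iff_right hp.one_lt).mp (h1.trans (h2.trans h3))

/-- The rank of a product of cyclic groups is at most the number of factors. -/
theorem Group.rank_le_card_of_mulEquiv_pi_zmod {G : Type*} [Group G] [Group.FG G] {ι : Type*}
    [Fintype ι] {n : ι → ℕ} (g : G ≃* ((i : ι) → Multiplicative (ZMod (n i)))) :
    Group.rank G ≤ Fintype.card ι := by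
  classical
  let s : ι → G := fun i => g.symm (Pi.mulSingle i (Multiplicative.ofAdd 1))
  have hs : Subgroup.closure ((Finset.univ.image s : Finset G) : Set G) = ⊤ := by
    rw [eq_top_iff]
    intro x _
    have hx : g x ∈ (Subgroup.closure ((Finset.univ.image s : Finset G) : Set G)).map
        g.toMonoidHom := by
      rw [← Finset.univ_prod_mulSingle (g x)]
      refine Subgroup.prod_mem _ fun i _ => ?_
      refine ⟨s i ^ ((g x i).toAdd.cast : ℤ), Subgroup.zpow_mem _
        (Subgroup.subset_closure (by simp)) _, ?_⟩
      have : g.toMonoidHom (s i) = Pi.mulSingle i (Multiplicative.ofAdd 1) := g.apply_symm_apply _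
      rw [map_zpow, this, ← Pi.mulSingle_zpow, ← ofAdd_zsmul, zsmul_one, ZMod.intCast_zmod_cast,
        ofAdd_toAdd]
    obtain ⟨y, hy, hyx⟩ := hx
    exact g.injective hyx ▸ hy
  exact (Group.rank_le hs).trans Finset.card_image_le

theorem isCyclic_of_rank_le_one {G : Type*} [Group G] [Group.FG G] (h : Group.rank G ≤ 1) :
    IsCyclic G := by
  obtain ⟨S, hS, hcl⟩ := Group.rank_spec G
  obtain ⟨x, hx⟩ := Finset.card_le_one_iff_subset_singleton.mp (hS.trans_le h)
  refine ⟨x, fun y => ?_⟩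
  change y ∈ Subgroup.zpowers x
  rw [Subgroup.zpowers_eq_closure]
  exact Subgroup.closure_mono (by exact_mod_cast hx) (hcl ▸ Subgroup.mem_top y)

/-- A product of cyclic groups of pairwise coprime orders is cyclic. -/
theorem isCyclic_of_mulEquiv_pi_zmod {G : Type*} [Group G] {ι : Type*} [Fintype ι] {n : ι → ℕ}
    (hn : Pairwise (Function.onFun Nat.Coprime n))
    (g : G ≃* ((i : ι) → Multiplicative (ZMod (n i)))) : IsCyclic G := by
  have e := ZMod.prodEquivPi n hn
  let k : Multiplicative (ZMod (∏ i, n i)) →* ((i : ι) → Multiplicative (ZMod (n i))) :=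
    { toFun := fun x i => Multiplicative.ofAdd (e x.toAdd i)
      map_one' := by ext i; simp
      map_mul' := fun x y => by ext i; simp }
  refine isCyclic_of_surjective (g.symm.toMonoidHom.comp k) (g.symm.surjective.comp fun y => ?_)
  refine ⟨Multiplicative.ofAdd (e.symm fun i => (y i).toAdd), ?_⟩
  ext i
  simp [k]

/-- The subgroup lattice of a product with three nontrivial factors is not dismantlable. -/
theorem not_isDismantlable_subgroup_of_mulEquiv_pi {G : Type*} [CommGroup G] [Finite G]
    {ι : Type*} {M : ι → Type*} [∀ i, CommGroup (M i)] [∀ i, Nontrivial (M i)]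
    (g : G ≃* ((i : ι) → M i)) {i j k : ι} (hij : i ≠ j) (hik : i ≠ k) (hjk : j ≠ k) :
    ¬ IsDismantlable (Subgroup G) := by
  classical
  let A : ι → Subgroup G := fun i => (g.symm.toMonoidHom.comp (MonoidHom.mulSingle M i)).range
  have hbot : ∀ i, A i ≠ ⊥ := fun i h => by
    obtain ⟨x, hx⟩ := exists_ne (1 : M i)
    have h1 : g.symm (Pi.mulSingle i x) ∈ A i := ⟨x, rfl⟩
    rw [h, Subgroup.mem_bot] at h1
    simp_all
  -- The other factors vanish in coordinate `i`, which is faithful on `A i`; independence follows.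
  have hle : ∀ i j, i ≠ j → A j ≤ ((Pi.evalMonoidHom M i).comp g.toMonoidHom).ker := by
    rintro i j hij _ ⟨x, rfl⟩
    simp [MonoidHom.mem_ker, hij]
  have hdis : ∀ i j k, i ≠ j → i ≠ k → Disjoint (A i) (A j ⊔ A k) := by
    intro i j k hij hik
    rw [Subgroup.disjoint_def]
    rintro _ ⟨x, rfl⟩ hx
    have := MonoidHom.mem_ker.mp (sup_le (hle i j hij) (hle i k hik) hx)
    have hx1 : x = 1 := by simpa using this
    rw [hx1, map_one]
  exact not_isDismantlable_of_independent (hbot i) (hbot j) (hbot k) (hdis i j k hij hik)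
    (hdis j i k hij.symm hjk) (hdis k i j hik.symm hjk.symm)

theorem IsPGroup.eq_of_surjective_zmod {p t : ℕ} (hp : p.Prime) (ht : t.Prime) {G : Type*}
    [Group G] [Finite G] (hG : IsPGroup p G) {N : Subgroup G} (f : N →* Multiplicative (ZMod t))
    (hf : Function.Surjective f) : t = p := by
  have : Fact p.Prime := ⟨hp⟩
  obtain ⟨n, hn⟩ := hG.exists_card_eq
  have h := Subgroup.card_dvd_of_surjective f hf
  rw [Nat.card_congr Multiplicative.toAdd, Nat.card_zmod] at h
  have h' := h.trans N.card_subgroup_dvd_card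
  rw [hn] at h'
  exact (Nat.prime_dvd_prime_iff_eq ht hp).mp (ht.dvd_of_dvd_pow h')

/-- A finite abelian `p`-group of rank at least three has a quotient of type `(p, p, p)`. -/
theorem HasSectionPPP.of_three_le_rank {p : ℕ} (hp : p.Prime) {G : Type*} [CommGroup G] [Finite G]
    (hG : IsPGroup p G) (h : 3 ≤ Group.rank G) : HasSectionPPP p G := by
  obtain ⟨ι, _, q, e, hq, he, ⟨g⟩⟩ := CommGroup.exists_mulEquiv_pi_zmod_prime_pow G
  classical
  let φ : ∀ i, (⊤ : Subgroup G) →* Multiplicative (ZMod (q i)) := fun i =>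
    (ZMod.mulCastHom (dvd_pow_self (q i) (he i))).comp
      ((Pi.evalMonoidHom _ i).comp (g.toMonoidHom.comp (⊤ : Subgroup G).subtype))
  have hφ : ∀ i, Function.Surjective (φ i) := fun i =>
    (ZMod.mulCastHom_surjective _).comp ((Function.surjective_eval i).comp
      (g.surjective.comp fun x => ⟨⟨x, trivial⟩, rfl⟩))
  -- Each factor has a quotient of order `q i`, so `p` is the only prime that occurs.
  obtain rfl : q = fun _ => p := funext fun i => hG.eq_of_surjective_zmod hp (hq i) (φ i) (hφ i)
  obtain ⟨i, j, k, hij, hik, hjk⟩ := Fintype.two_lt_card_iff.mp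
    (h.trans (Group.rank_le_card_of_mulEquiv_pi_zmod g))
  refine HasSectionPPP.of_surjective ((φ i).prod ((φ j).prod (φ k))) fun ⟨u, v, w⟩ => ?_
  obtain ⟨u, rfl⟩ := ZMod.mulCastHom_surjective (dvd_pow_self p (he i)) u
  obtain ⟨v, rfl⟩ := ZMod.mulCastHom_surjective (dvd_pow_self p (he j)) v
  obtain ⟨w, rfl⟩ := ZMod.mulCastHom_surjective (dvd_pow_self p (he k)) w
  let x : (i : ι) → Multiplicative (ZMod (p ^ e i)) :=
    Pi.mulSingle i u * Pi.mulSingle j v * Pi.mulSingle k w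
  refine ⟨⟨g.symm x, trivial⟩, ?_⟩
  simp [φ, x, hij, hij.symm, hik, hik.symm, hjk, hjk.symm]

/-- The subgroup lattice of a finite abelian `p`-group of rank at most two is dismantlable. -/
theorem IsPGroup.isDismantlable_subgroup {p : ℕ} (hp : p.Prime) {G : Type*} [CommGroup G]
    [Finite G] (hG : IsPGroup p G) (h : Group.rank G ≤ 2) : IsDismantlable (Subgroup G) := by
  refine isDismantlable_of_breadth_le_two fun A B C => ?_
  by_contra! hABC
  obtain ⟨N, a, b, c, ha, hb, hc, f, hf⟩ :=
    Subgroup.exists_surjective_prod_zmod_of_not_le hABC.1 hABC.2.1 hABC.2.2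
  have key : ∀ {t : ℕ}, t.Prime → ∀ g : N →* Multiplicative (ZMod t), Function.Surjective g →
      t = p := fun ht g hg => hG.eq_of_surjective_zmod hp ht g hg
  obtain rfl := key ha ((MonoidHom.fst _ _).comp f) (Prod.fst_surjective.comp hf)
  obtain rfl := key hb (((MonoidHom.fst _ _).comp (MonoidHom.snd _ _)).comp f)
    (Prod.fst_surjective.comp (Prod.snd_surjective.comp hf))
  obtain rfl := key hc (((MonoidHom.snd _ _).comp (MonoidHom.snd _ _)).comp f)
    (Prod.snd_surjective.comp (Prod.snd_surjective.comp hf))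
  have := (HasSectionPPP.of_surjective f hf).three_le_rank hp
  omega

/-! ### Groups with dismantlable subgroup lattice -/

theorem Nat.card_eq_prod_of_mulEquiv_pi_zmod {G : Type*} [Group G] {ι : Type*} [Fintype ι]
    {n : ι → ℕ} (g : G ≃* ((i : ι) → Multiplicative (ZMod (n i)))) :
    Nat.card G = ∏ i, n i := by
  rw [Nat.card_congr g.toEquiv, Nat.card_pi]
  exact Finset.prod_congr rfl fun i _ => by
    rw [Nat.card_congr Multiplicative.toAdd, Nat.card_zmod]

/-- If the subgroup lattice of a finite abelian group is dismantlable, the group is cyclic with at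
most two prime divisors or a `p`-group of rank two. -/
theorem IsDismantlable.isCyclic_or_rank_eq_two {G : Type*} [CommGroup G] [Finite G]
    (h : IsDismantlable (Subgroup G)) :
    (IsCyclic G ∧ ∃ p q n m : ℕ, p.Prime ∧ q.Prime ∧ Nat.card G = p ^ n * q ^ m) ∨
      ∃ p : ℕ, p.Prime ∧ IsPGroup p G ∧ Group.rank G = 2 := by
  classical
  obtain ⟨ι, _, p, e, hp, he, ⟨g⟩⟩ := CommGroup.exists_mulEquiv_pi_zmod_prime_pow G
  have hcard : Fintype.card ι ≤ 2 := by
    by_contra! hlt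
    obtain ⟨i, j, k, hij, hik, hjk⟩ := Fintype.two_lt_card_iff.mp hlt
    have : ∀ i, Nontrivial (Multiplicative (ZMod (p i ^ e i))) := fun i => by
      have : Fact (1 < p i ^ e i) := ⟨Nat.one_lt_pow (he i) (hp i).one_lt⟩
      infer_instance
    exact not_isDismantlable_subgroup_of_mulEquiv_pi g hij hik hjk h
  have hprod := Nat.card_eq_prod_of_mulEquiv_pi_zmod g
  by_cases hinj : Function.Injective p
  · have hcyc : IsCyclic G := isCyclic_of_mulEquiv_pi_zmod (fun i j hij =>
      Nat.Coprime.pow _ _ ((Nat.coprime_primes (hp i) (hp j)).mpr (hinj.ne hij))) g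
    refine Or.inl ⟨hcyc, ?_⟩
    rw [← Finset.card_univ] at hcard
    interval_cases hc : (Finset.univ : Finset ι).card
    · rw [Finset.card_eq_zero] at hc
      -- The trivial group: an empty product, for which any primes serve.
      exact ⟨2, 2, 0, 0, Nat.prime_two, Nat.prime_two, by simp [hprod, hc]⟩
    · obtain ⟨i, hi⟩ := Finset.card_eq_one.mp hc
      exact ⟨p i, p i, e i, 0, hp i, hp i, by simp [hprod, hi]⟩
    · obtain ⟨i, j, hij, hi⟩ := Finset.card_eq_two.mp hc
      exact ⟨p i, p j, e i, e j, hp i, hp j, by rw [hprod, hi, Finset.prod_pair hij]⟩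
  · obtain ⟨i, j, hpij, hij⟩ : ∃ i j, p i = p j ∧ i ≠ j := by
      simpa [Function.Injective] using hinj
    -- Two factors already share a prime, and a third factor is excluded.
    have hall : ∀ k, p k = p i := fun k => by
      by_contra hk
      refine absurd (Fintype.two_lt_card_iff.mpr ⟨i, j, k, hij, ?_, ?_⟩) hcard.not_gt
      · rintro rfl; exact hk rfl
      · rintro rfl; exact hk hpij.symm
    have hpow : Nat.card G = p i ^ ∑ k, e k := by
      rw [hprod, ← Finset.prod_pow_eq_pow_sum]
      exact Finset.prod_congr rfl fun k _ => by rw [hall k]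
    have hrank : Group.rank G ≤ 2 := (Group.rank_le_card_of_mulEquiv_pi_zmod g).trans hcard
    -- Rank below two need not be refuted: it makes `G` cyclic of prime power order.
    rcases hrank.eq_or_lt with h2 | h2
    · exact Or.inr ⟨p i, hp i, IsPGroup.of_card hpow, h2⟩
    · exact Or.inl ⟨isCyclic_of_rank_le_one (by omega), p i, p i, ∑ k, e k, 0, hp i, hp i,
        by rw [hpow, pow_zero, mul_one]⟩

theorem theorem2p3 (G : Type*) [CommGroup G] [Finite G] :
    (IsDismantlable (Subgroup G) ↔
      (IsCyclic G ∧ ((∃ p n : ℕ, p.Prime ∧ Nat.card G = p ^ n) ∨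
        ∃ p q n m : ℕ, p.Prime ∧ q.Prime ∧ Nat.card G = p ^ n * q ^ m)) ∨
      ∃ p : ℕ, p.Prime ∧ IsPGroup p G ∧ Group.rank G = 2) ∧
    ∀ p : ℕ, p.Prime → IsPGroup p G → (Group.rank G ≤ 2 ↔ ¬ HasSectionPPP p G) := by
  refine ⟨⟨fun h => ?_, ?_⟩, fun p hp hG => ⟨fun h hs => ?_, fun h => ?_⟩⟩
  -- The two-prime form includes prime powers, by a zero exponent.
  · exact h.isCyclic_or_rank_eq_two.imp_left fun h => ⟨h.1, Or.inr h.2⟩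
  · rintro (⟨hcyc, ⟨p, n, hp, hn⟩ | ⟨p, q, n, m, hp, hq, hn⟩⟩ | ⟨p, hp, hG, hr⟩)
    · exact IsCyclic.isDismantlable_subgroup (n := n) (m := 0) hp hp (by rw [hn, pow_zero, mul_one])
    · exact IsCyclic.isDismantlable_subgroup hp hq hn
    · exact hG.isDismantlable_subgroup hp hr.le
  · have := hs.three_le_rank hp
    omega
  · by_contra! hlt
    exact h (HasSectionPPP.of_three_le_rank hp hG hlt)
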